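/- \textbf{Model.} Let $\Theta$ (states) and $\mathcal M$ (messages) be finite sets with $|\mathcal M|\ge|\Theta|$, let $\rho$ be a probability distribution (prior) on $\Theta$, and let $\mathcal A=[0,1]$ be the set of actions. The agent's utility $u_A:\mathcal A\to[0,1]$ is continuous and strictly increasing with $u_A(0)=0$, $u_A(1)=1$; the principal's utility $u_P:\mathcal A\times\Theta\to[0,1]$ is continuous in the action; and there are two distinct states $\theta_0,\theta_1$ such that action $0$ maximizes $u_P(\cdot,\theta_0)$ and action $1$ maximizes $u_P(\cdot,\theta_1)$. A \emph{mechanism} $Q=(\pi,\chi)$ consists of lotteries $\pi_m\in\Delta(\mathcal A)$, $m\in\mathcal M$, and $\chi\in[0,1]$. Let $\sigma_A:\Theta\to\Delta(\mathcal M)$ be a messaging strategy of the agent and $\sigma_P:\mathcal M\to\Delta(\mathcal A)$ a strategy of the uncommitted principal. Put $U_A(m)=\chi\,\mathbb E_{\pi_m}[u_A]+(1-\chi)\,\mathbb E_{\sigma_P(m)}[u_A]$ and $P(m)=\sum_\theta\rho(\theta)\sigma_A(m|\theta)$; the message $m$ is \emph{on path} if $P(m)>0$, and then $\mu(\theta|m)=\rho(\theta)\sigma_A(m|\theta)/P(m)$.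 We say that $\sigma_P$ is a \emph{best response} to $\sigma_A$ if, for each on-path $m$, $\sigma_P(m)$ is supported on the maximizers of $a\mapsto\sum_\theta\mu(\theta|m)u_P(a,\theta)$. The pair $(\sigma_A,\sigma_P)$ is an \emph{equilibrium} of $Q$, written $(\sigma_A,\sigma_P)\in\mathcal E(Q)$, if (i) for each $\theta$, $\sigma_A(\cdot|\theta)$ is supported on the maximizers of $U_A$ over $\mathcal M$; (ii) $\sigma_P$ is a best response to $\sigma_A$; (iii) for each off-path $m$, $\sigma_P(m)$ is a best response to some belief and is the action $0$, the worst one for the agent; (iv) $P(m)<1$ for all $m$. The principal's payoff is \[V(Q,(\sigma_A,\sigma_P))=\sum_{\theta,m}\rho(\theta)\sigma_A(m|\theta)\bigl(\chi\,\mathbb E_{\pi_m}[u_P(a,\theta)]+(1-\chi)\,\mathbb E_{\sigma_P(m)}[u_P(a,\theta)]\bigr).\] \textbf{Optimal payoffs.} The \emph{optimal payoff} is $\overline V=\sup_Q\sup_{E\in\mathcal E(Q)}V(Q,E)$. A payoff $v$ is \emph{worst-case $\chi$-implementable} for $\chi<1$ if $v=\inf_{E\in\mathcal E(Q)}V(Q,E)$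 for some $Q=(\pi,\chi)$, and \emph{worst-case $1$-implementable} if $v=\lim_k v_k$ for some worst-case $\chi_k$-implementable $v_k$ with $\chi_k<1$, $\chi_k\to1$. The \emph{worst-case optimal payoff} $V^\star$ is the supremum of all worst-case $\chi$-implementable payoffs over $\chi\in[0,1]$. If $\mathcal E(Q)=\varnothing$, the inner infimum and supremum are taken to be $V_B=\max_{a}\sum_\theta\rho(\theta)u_P(a,\theta)$. \textbf{Polarizing strategies.} A messaging strategy $\sigma$ with exactly two on-path messages $m_1,m_2$ is called a \emph{two-message strategy}, and \[\Delta(\sigma)=\sup\bigl\{\bigl|\mathbb E_{\sigma_P(m_1)}[u_A]-\mathbb E_{\sigma_P(m_2)}[u_A]\bigr| : \sigma_P\text{ a best response to }\sigma\bigr\}.\] The \emph{polarizing strategies} are the two-message strategies that maximize $\Delta$ among all two-message strategies. A messaging strategy is \emph{truth-telling} if distinct states send distinct messages, each with probability one. \textbf{Proposition.} Suppose $|\Theta|=2$ and the polarizing strategy exists and is unique up to relabeling of the messages. Then $V^\star=\overline V$. Moreover, the polarizing strategies are exactly the truth-telling strategies; that is, truth-telling is the unique polarizing strategy up to relabeling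 of the messages. -/

import Mathlib

open MeasureTheory Filter Topology

noncomputable section

/-- The primitives of the communication game between a principal and an agent: finite sets `Θ` of
states and `M` of messages, the action space `[0,1]`, the prior `ρ`, the agent's utility `uA`
(state independent) and the principal's utility `uP`. -/
structure CommunicationGame (Θ M : Type*) [Fintype Θ] [Fintype M] where
  card_le : Fintype.card Θ ≤ Fintype.card M
  /-- The common prior. -/
  ρ : Θ → ℝ
  ρ_mem : ρ ∈ stdSimplex ℝ Θ
  /-- The agent's utility from an action. -/
  uA : unitInterval → ℝ
  uA_continuous : Continuous uA
  uA_strictMono : StrictMono uA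
  uA_zero : uA 0 = 0
  uA_one : uA 1 = 1
  /-- The principal's utility from an action in a state. -/
  uP : unitInterval → Θ → ℝ
  uP_continuous : ∀ θ, Continuous fun a => uP a θ
  uP_mem : ∀ a θ, uP a θ ∈ Set.Icc (0 : ℝ) 1
  /-- The extreme actions `0` and `1` are optimal for the principal in two distinct states. -/
  extreme_optimal : ∃ θ₀ θ₁ : Θ, θ₀ ≠ θ₁ ∧ (∀ a, uP a θ₀ ≤ uP 0 θ₀) ∧ (∀ a, uP a θ₁ ≤ uP 1 θ₁)

namespace CommunicationGame

/-- A mechanism `Q = (π, χ)`: a committed lottery over actions after each message, and the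
probability `χ` with which the principal is bound by it. -/
structure Mechanism (M : Type*) where
  π : M → ProbabilityMeasure unitInterval
  χ : unitInterval

/-- A messaging strategy of the agent; `σ θ m` is the probability of message `m` in state `θ`. -/
abbrev MessagingStrategy (Θ M : Type*) [Fintype M] := Θ → {p : M → ℝ // p ∈ stdSimplex ℝ M}

/-- A strategy of the uncommitted principal: a lottery over actions after each message. -/
abbrev ActionStrategy (M : Type*) := M → ProbabilityMeasure unitInterval

variable {Θ M : Type*} [Fintype Θ] [Fintype M] (G : CommunicationGame Θ M)

/-- Expected utility of the agent under a lottery over actions. -/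
def agentUtility (l : ProbabilityMeasure unitInterval) : ℝ := ∫ a, G.uA a ∂(l : Measure unitInterval)

/-- Expected utility of the principal in state `θ` under a lottery over actions. -/
def principalUtility (l : ProbabilityMeasure unitInterval) (θ : Θ) : ℝ := ∫ a, G.uP a θ ∂(l : Measure unitInterval)

/-- Ex-ante probability of a message. -/
def messageProb (σ : MessagingStrategy Θ M) (m : M) : ℝ := ∑ θ, (σ θ).1 m * G.ρ θ

/-- A message is on path if it is sent with positive ex-ante probability. -/
def OnPath (σ : MessagingStrategy Θ M) (m : M) : Prop := 0 < G.messageProb σ m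

/-- Bayesian posterior belief after a message (used for on-path messages only). -/
def posterior (σ : MessagingStrategy Θ M) (m : M) (θ : Θ) : ℝ :=
  (σ θ).1 m * G.ρ θ / G.messageProb σ m

/-- Actions that maximize the principal's expected utility given the belief `μ`. -/
def optimalActions (μ : Θ → ℝ) : Set unitInterval :=
  {a | ∀ b, ∑ θ, μ θ * G.uP b θ ≤ ∑ θ, μ θ * G.uP a θ}

/-- A lottery over actions is a best response to the belief `μ` if it is concentrated on the
actions that are optimal given `μ`. -/
def IsBestResponse (μ : Θ → ℝ) (l : ProbabilityMeasure unitInterval) : Prop :=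
  ∀ᵐ a ∂(l : Measure unitInterval), a ∈ G.optimalActions μ

/-- The uncommitted principal best-responds to `σ` after every on-path message. -/
def BestResponds (σ : MessagingStrategy Θ M) (τ : ActionStrategy M) : Prop :=
  ∀ m, G.OnPath σ m → G.IsBestResponse (G.posterior σ m) (τ m)

/-- The agent's expected payoff from sending the message `m`. -/
def messagePayoff (Q : Mechanism M) (τ : ActionStrategy M) (m : M) : ℝ :=
  (Q.χ : ℝ) * G.agentUtility (Q.π m) + (1 - (Q.χ : ℝ)) * G.agentUtility (τ m)

/-- Equilibria of the game induced by the mechanism `Q`. -/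
structure IsEquilibrium (Q : Mechanism M) (σ : MessagingStrategy Θ M) (τ : ActionStrategy M) :
    Prop where
  agent_optimal : ∀ θ m, 0 < (σ θ).1 m → ∀ m', G.messagePayoff Q τ m' ≤ G.messagePayoff Q τ m
  principal_optimal : G.BestResponds σ τ
  /-- Off path, the principal best-responds to some belief ... -/
  off_path : ∀ m, ¬ G.OnPath σ m → ∃ μ ∈ stdSimplex ℝ Θ, G.IsBestResponse μ (τ m)
  /-- ... and takes the action that yields the agent his lowest possible payoff. -/
  pessimistic : ∀ m, ¬ G.OnPath σ m → τ m = ⟨Measure.dirac 0, inferInstance⟩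
  no_perfect_pooling : ∀ m, G.messageProb σ m < 1

/-- The principal's expected payoff from a mechanism and a strategy profile. -/
def payoff (Q : Mechanism M) (σ : MessagingStrategy Θ M) (τ : ActionStrategy M) : ℝ :=
  (Q.χ : ℝ) * ∑ θ, ∑ m, G.ρ θ * (σ θ).1 m * G.principalUtility (Q.π m) θ +
    (1 - (Q.χ : ℝ)) * ∑ θ, ∑ m, G.ρ θ * (σ θ).1 m * G.principalUtility (τ m) θ

/-- The set of the principal's equilibrium payoffs under a mechanism. -/
def equilibriumPayoffs (Q : Mechanism M) : Set ℝ :=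
  {v | ∃ σ τ, G.IsEquilibrium Q σ τ ∧ v = G.payoff Q σ τ}

/-- The no-communication payoff `V_B`. -/
def noCommunicationPayoff : ℝ := ⨆ a : unitInterval, ∑ θ, G.ρ θ * G.uP a θ

open Classical in
/-- The lowest equilibrium payoff under `Q`; the no-communication payoff if there is no
equilibrium. -/
def worstPayoff (Q : Mechanism M) : ℝ :=
  if (G.equilibriumPayoffs Q).Nonempty then sInf (G.equilibriumPayoffs Q)
  else G.noCommunicationPayoff

open Classical in
/-- The highest equilibrium payoff under `Q`; the no-communication payoff if there is no
equilibrium. -/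
def bestPayoff (Q : Mechanism M) : ℝ :=
  if (G.equilibriumPayoffs Q).Nonempty then sSup (G.equilibriumPayoffs Q)
  else G.noCommunicationPayoff

/-- Worst-case `χ`-implementable payoffs: for `χ < 1` the lowest equilibrium payoffs of mechanisms
with commitment level `χ`, for `χ = 1` the limits of worst-case `χ n`-implementable payoffs
along sequences `χ n → 1`, `χ n < 1`. -/
def WorstCaseImplementable (χ : unitInterval) (v : ℝ) : Prop :=
  (χ < 1 ∧ ∃ π : M → ProbabilityMeasure unitInterval, v = G.worstPayoff ⟨π, χ⟩) ∨
  (χ = 1 ∧ ∃ (c : ℕ → unitInterval) (w : ℕ → ℝ),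
    (∀ n, c n < 1 ∧ ∃ π : M → ProbabilityMeasure unitInterval, w n = G.worstPayoff ⟨π, c n⟩) ∧
    Tendsto c atTop (𝓝 1) ∧ Tendsto w atTop (𝓝 v))

/-- The worst-case optimal payoff `V*`. -/
def worstCaseOptimalPayoff : ℝ := sSup {v | ∃ χ : unitInterval, G.WorstCaseImplementable χ v}

/-- The optimal payoff `V̄`: the supremum over all mechanisms and all their equilibria. -/
def optimalPayoff : ℝ := ⨆ Q : Mechanism M, G.bestPayoff Q

/-- A two-message strategy: exactly two messages are on path. -/
def IsTwoMessage (σ : MessagingStrategy Θ M) : Prop := {m | G.OnPath σ m}.ncard = 2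

/-- The largest spread between the agent's payoffs after the two on-path messages of `σ` that
best responses of the uncommitted principal can induce. -/
def spread (σ : MessagingStrategy Θ M) : ℝ :=
  sSup {d | ∃ τ : ActionStrategy M, G.BestResponds σ τ ∧ ∃ m₁ m₂, m₁ ≠ m₂ ∧
    G.OnPath σ m₁ ∧ G.OnPath σ m₂ ∧ d = |G.agentUtility (τ m₁) - G.agentUtility (τ m₂)|}

/-- Polarizing strategies: two-message strategies with the largest spread. -/
def IsPolarizing (σ : MessagingStrategy Θ M) : Prop :=
  G.IsTwoMessage σ ∧ ∀ σ', G.IsTwoMessage σ' → G.spread σ' ≤ G.spread σ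

/-- There is exactly one polarizing strategy, up to relabeling of the messages. -/
def UniquePolarizing : Prop :=
  ∃ σ, G.IsPolarizing σ ∧ ∀ σ', G.IsPolarizing σ' →
    ∃ e : Equiv.Perm M, ∀ θ m, (σ' θ).1 m = (σ θ).1 (e m)

/-- Truth-telling: different states send different messages, each with probability one. -/
def IsTruthTelling (σ : MessagingStrategy Θ M) : Prop :=
  ∃ f : Θ → M, Function.Injective f ∧ ∀ θ, (σ θ).1 (f θ) = 1

end CommunicationGame

end

/-! The agent's utility does not depend on the state. In equilibrium every message sent in any state
therefore has the same maximal payoff, and averaging over messages and over commitment gives one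
lottery per state with equal agent utility (`IsEquilibrium.exists_lotteries`). It suffices to
guarantee nearly the payoff of any such pair `l₀`, `l₁` in the worst case.

Perturb the pair so that `m₀` is better than `m₁` by `ε` under commitment, let all other messages
yield `0`, and choose `χ` with `1 - χ = ε * χ`. The uncommitted responses can then offset the gap
only by using their whole utility range. Perfect pooling is excluded, so both messages are sent and
the agent is indifferent. Hence the responses are exactly the actions `0` and `1`, and the strategy
attains the largest conceivable spread, `1`. It is polarizing, and by uniqueness truth-telling
(`IsSeparating.truthful`). All equilibria thus pay at least the committed part of the intended
payoff, and `ε → 0` concludes.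

Uniqueness is used three times: it excludes null states, where behaviour would be arbitrary; it
identifies polarizing strategies with truth-telling, which has spread `1`; and it prevents action
`1` from being optimal in `θ₀`, which fixes which state sends which message. -/

namespace CommunicationGame

/-! ### Lotteries over actions and their finite mixtures -/

/-- The degenerate lottery at an action. -/
noncomputable def pureLottery (a : unitInterval) : ProbabilityMeasure unitInterval :=
  ⟨Measure.dirac a, inferInstance⟩

theorem integrable_lottery {f : unitInterval → ℝ} (hf : Continuous f)
    (l : ProbabilityMeasure unitInterval) : Integrable f (l : Measure unitInterval) :=
  hf.integrable_of_hasCompactSupport (HasCompactSupport.of_compactSpace f)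

theorem integral_pureLottery (f : unitInterval → ℝ) (a : unitInterval) :
    ∫ x, f x ∂(pureLottery a : Measure unitInterval) = f a := by
  change ∫ x, f x ∂(Measure.dirac a) = f a
  simp

/-- Finite mixtures of lotteries. -/
theorem exists_mixture {ι : Type*} [Fintype ι] {w : ι → ℝ} (hw : w ∈ stdSimplex ℝ ι)
    (l : ι → ProbabilityMeasure unitInterval) :
    ∃ L : ProbabilityMeasure unitInterval, ∀ f : unitInterval → ℝ, Continuous f →
      ∫ a, f a ∂(L : Measure unitInterval) =
        ∑ i, w i * ∫ a, f a ∂(l i : Measure unitInterval) := by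
  have hp : IsProbabilityMeasure
      (∑ i, ENNReal.ofReal (w i) • (l i : Measure unitInterval)) := by
    constructor
    simp only [Measure.coe_finsetSum, Finset.sum_apply, Measure.smul_apply, smul_eq_mul,
      measure_univ, mul_one]
    rw [← ENNReal.ofReal_sum_of_nonneg fun i _ => hw.1 i, hw.2, ENNReal.ofReal_one]
  refine ⟨⟨_, hp⟩, fun f hf => ?_⟩
  change ∫ a, f a ∂(∑ i, ENNReal.ofReal (w i) • (l i : Measure unitInterval)) = _
  rw [integral_finsetSum_measure fun i _ =>
    (integrable_lottery hf (l i)).smul_measure ENNReal.ofReal_ne_top]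
  refine Finset.sum_congr rfl fun i _ => ?_
  rw [integral_smul_measure, ENNReal.toReal_ofReal (hw.1 i), smul_eq_mul]

theorem exists_mixture_two {s t : ℝ} (hs : 0 ≤ s) (ht : 0 ≤ t) (h : s + t = 1)
    (l l' : ProbabilityMeasure unitInterval) :
    ∃ L : ProbabilityMeasure unitInterval, ∀ f : unitInterval → ℝ, Continuous f →
      ∫ a, f a ∂(L : Measure unitInterval) =
        s * ∫ a, f a ∂(l : Measure unitInterval) + t * ∫ a, f a ∂(l' : Measure unitInterval) := by
  obtain ⟨L, hL⟩ := exists_mixture (w := ![s, t])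
    ⟨fun i => by fin_cases i <;> simpa, by simpa using h⟩ ![l, l']
  exact ⟨L, fun f hf => by simpa using hL f hf⟩

variable {Θ M : Type*} [Fintype Θ] [Fintype M] (G : CommunicationGame Θ M)

/-! ### Utility bounds and optimal actions -/

theorem uA_mem (a : unitInterval) : G.uA a ∈ Set.Icc (0 : ℝ) 1 :=
  ⟨G.uA_zero ▸ G.uA_strictMono.monotone unitInterval.nonneg',
    G.uA_one ▸ G.uA_strictMono.monotone unitInterval.le_one'⟩

theorem integral_lottery_mem {f : unitInterval → ℝ} (hf : Continuous f)
    (h : ∀ a, f a ∈ Set.Icc (0 : ℝ) 1) (l : ProbabilityMeasure unitInterval) :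
    ∫ a, f a ∂(l : Measure unitInterval) ∈ Set.Icc (0 : ℝ) 1 := by
  refine ⟨integral_nonneg fun a => (h a).1, ?_⟩
  have := integral_mono (integrable_lottery hf l) (integrable_const (1 : ℝ)) fun a => (h a).2
  simpa using this

theorem agentUtility_mem (l : ProbabilityMeasure unitInterval) :
    G.agentUtility l ∈ Set.Icc (0 : ℝ) 1 :=
  integral_lottery_mem G.uA_continuous G.uA_mem l

theorem principalUtility_mem (l : ProbabilityMeasure unitInterval) (θ : Θ) :
    G.principalUtility l θ ∈ Set.Icc (0 : ℝ) 1 :=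
  integral_lottery_mem (G.uP_continuous θ) (fun a => G.uP_mem a θ) l

theorem agentUtility_pureLottery (a : unitInterval) : G.agentUtility (pureLottery a) = G.uA a :=
  integral_pureLottery _ a

theorem principalUtility_pureLottery (a : unitInterval) (θ : Θ) :
    G.principalUtility (pureLottery a) θ = G.uP a θ :=
  integral_pureLottery _ a

theorem isBestResponse_pureLottery {μ : Θ → ℝ} {a : unitInterval} (h : a ∈ G.optimalActions μ) :
    G.IsBestResponse μ (pureLottery a) := by
  change ∀ᵐ x ∂(Measure.dirac a), x ∈ G.optimalActions μ
  simpa [ae_dirac_eq] using h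

/-- If a best response gives the agent the extreme utility of action `a`, then `a` is optimal. -/
theorem mem_optimalActions_of_ae {μ : Θ → ℝ} {l : ProbabilityMeasure unitInterval}
    (hl : G.IsBestResponse μ l) {a : unitInterval}
    (h : ∀ᵐ x ∂(l : Measure unitInterval), G.uA x = G.uA a) : a ∈ G.optimalActions μ := by
  obtain ⟨x, hx, hxa⟩ := (hl.and h).exists
  exact G.uA_strictMono.injective hxa ▸ hx

theorem one_mem_optimalActions {μ : Θ → ℝ} {l : ProbabilityMeasure unitInterval}
    (hl : G.IsBestResponse μ l) (h : G.agentUtility l = 1) : 1 ∈ G.optimalActions μ := by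
  refine G.mem_optimalActions_of_ae hl ?_
  have hi := integrable_lottery G.uA_continuous l
  -- The integrand is nonnegative, so a vanishing integral forces `uA = 1` almost surely.
  have h0 : ∫ a, (1 - G.uA a) ∂(l : Measure unitInterval) = 0 := by
    rw [integral_sub (integrable_const _) hi]
    simp only [integral_const, probReal_univ, smul_eq_mul, mul_one]
    exact sub_eq_zero.2 h.symm
  rw [integral_eq_zero_iff_of_nonneg (fun a => sub_nonneg.2 (G.uA_mem a).2)
    ((integrable_const _).sub hi)] at h0
  filter_upwards [h0] with a ha
  rw [G.uA_one]
  exact (sub_eq_zero.1 ha).symm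

/-! ### Payoff bounds and the easy inequality -/

theorem sum_prior_strategy_mul_mem (σ : MessagingStrategy Θ M) (f : M → Θ → ℝ)
    (hf : ∀ m θ, f m θ ∈ Set.Icc (0 : ℝ) 1) :
    ∑ θ, ∑ m, G.ρ θ * (σ θ).1 m * f m θ ∈ Set.Icc (0 : ℝ) 1 := by
  constructor
  · exact Finset.sum_nonneg fun θ _ => Finset.sum_nonneg fun m _ =>
      mul_nonneg (mul_nonneg (G.ρ_mem.1 θ) ((σ θ).2.1 m)) (hf m θ).1
  · calc _ ≤ ∑ θ, ∑ m, G.ρ θ * (σ θ).1 m := by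
          refine Finset.sum_le_sum fun θ _ => Finset.sum_le_sum fun m _ => ?_
          exact mul_le_of_le_one_right (mul_nonneg (G.ρ_mem.1 θ) ((σ θ).2.1 m)) (hf m θ).2
      _ = 1 := by
          simp only [← Finset.mul_sum, (σ _).2.2, mul_one, G.ρ_mem.2]

theorem payoff_mem (Q : Mechanism M) (σ : MessagingStrategy Θ M) (τ : ActionStrategy M) :
    G.payoff Q σ τ ∈ Set.Icc (0 : ℝ) 1 := by
  have h1 := G.sum_prior_strategy_mul_mem σ (fun m θ => G.principalUtility (Q.π m) θ)
    fun m θ => G.principalUtility_mem _ _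
  have h2 := G.sum_prior_strategy_mul_mem σ (fun m θ => G.principalUtility (τ m) θ)
    fun m θ => G.principalUtility_mem _ _
  exact convex_Icc (0 : ℝ) 1 h1 h2 Q.χ.2.1 (sub_nonneg.2 Q.χ.2.2) (by ring)

theorem bddAbove_equilibriumPayoffs (Q : Mechanism M) : BddAbove (G.equilibriumPayoffs Q) :=
  ⟨1, by rintro _ ⟨σ, τ, -, rfl⟩; exact (G.payoff_mem Q σ τ).2⟩

theorem bddBelow_equilibriumPayoffs (Q : Mechanism M) : BddBelow (G.equilibriumPayoffs Q) :=
  ⟨0, by rintro _ ⟨σ, τ, -, rfl⟩; exact (G.payoff_mem Q σ τ).1⟩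

theorem sum_prior_mul_le_one (a : unitInterval) : ∑ θ, G.ρ θ * G.uP a θ ≤ 1 := by
  rw [← G.ρ_mem.2]
  exact Finset.sum_le_sum fun θ _ => mul_le_of_le_one_right (G.ρ_mem.1 θ) (G.uP_mem a θ).2

theorem bestPayoff_le_one (Q : Mechanism M) : G.bestPayoff Q ≤ 1 := by
  unfold bestPayoff
  split_ifs with h
  · refine csSup_le h ?_
    rintro _ ⟨σ, τ, -, rfl⟩
    exact (G.payoff_mem Q σ τ).2
  · exact ciSup_le G.sum_prior_mul_le_one

/-- Without equilibria both sides take the same default value. -/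
theorem worstPayoff_le_bestPayoff (Q : Mechanism M) : G.worstPayoff Q ≤ G.bestPayoff Q := by
  unfold worstPayoff bestPayoff
  split_ifs with h
  · exact csInf_le_csSup h (G.bddBelow_equilibriumPayoffs Q) (G.bddAbove_equilibriumPayoffs Q)
  · exact le_rfl

theorem bestPayoff_le_optimalPayoff (Q : Mechanism M) : G.bestPayoff Q ≤ G.optimalPayoff :=
  le_ciSup (f := G.bestPayoff) ⟨1, by rintro _ ⟨Q, rfl⟩; exact G.bestPayoff_le_one Q⟩ Q

theorem WorstCaseImplementable.le_optimalPayoff {G : CommunicationGame Θ M} {χ : unitInterval}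
    {v : ℝ} (h : G.WorstCaseImplementable χ v) : v ≤ G.optimalPayoff := by
  have key (Q : Mechanism M) : G.worstPayoff Q ≤ G.optimalPayoff :=
    (G.worstPayoff_le_bestPayoff Q).trans (G.bestPayoff_le_optimalPayoff Q)
  obtain ⟨-, π, rfl⟩ | ⟨-, c, w, hw, -, hlim⟩ := h
  · exact key _
  · refine le_of_tendsto' hlim fun n => ?_
    obtain ⟨-, π, h⟩ := hw n
    exact h ▸ key _

theorem worstCaseOptimalPayoff_le_optimalPayoff :
    G.worstCaseOptimalPayoff ≤ G.optimalPayoff :=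
  csSup_le ⟨_, 0, Or.inl ⟨zero_lt_one, fun _ => pureLottery 0, rfl⟩⟩
    fun _ ⟨_, h⟩ => h.le_optimalPayoff

theorem worstPayoff_le_worstCaseOptimalPayoff (Q : Mechanism M) (h : Q.χ < 1) :
    G.worstPayoff Q ≤ G.worstCaseOptimalPayoff :=
  le_csSup ⟨G.optimalPayoff, fun _ ⟨_, h⟩ => h.le_optimalPayoff⟩
    ⟨Q.χ, Or.inl ⟨h, Q.π, rfl⟩⟩

/-! ### The spread is at most one -/

theorem abs_agentUtility_sub_le_one (l l' : ProbabilityMeasure unitInterval) :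
    |G.agentUtility l - G.agentUtility l'| ≤ 1 := by
  have h := G.agentUtility_mem l
  have h' := G.agentUtility_mem l'
  exact abs_le.2 ⟨by linarith [h.1, h'.2], by linarith [h.2, h'.1]⟩

theorem spread_le_one (σ : MessagingStrategy Θ M) : G.spread σ ≤ 1 :=
  Real.sSup_le (by rintro _ ⟨τ, -, m₁, m₂, -, -, -, rfl⟩; exact G.abs_agentUtility_sub_le_one _ _)
    zero_le_one

/-- A two-message strategy that supports the extreme actions is polarizing. -/
theorem IsTwoMessage.isPolarizing {G : CommunicationGame Θ M} {σ : MessagingStrategy Θ M}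
    (hσ : G.IsTwoMessage σ) {τ : ActionStrategy M} (hτ : G.BestResponds σ τ) {m₁ m₂ : M}
    (hne : m₁ ≠ m₂) (h₁ : G.OnPath σ m₁) (h₂ : G.OnPath σ m₂)
    (h0 : G.agentUtility (τ m₁) = 0) (h1 : G.agentUtility (τ m₂) = 1) : G.IsPolarizing σ := by
  refine ⟨hσ, fun σ' _ => (G.spread_le_one σ').trans (le_csSup ⟨1, ?_⟩ ?_)⟩
  · rintro _ ⟨τ, -, m₁, m₂, -, -, -, rfl⟩
    exact G.abs_agentUtility_sub_le_one _ _
  · exact ⟨τ, hτ, m₁, m₂, hne, h₁, h₂, by rw [h0, h1]; norm_num⟩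

/-! ### Pure and even message lotteries -/

/-- The message `m` for sure. -/
noncomputable def pureMessage (m : M) : {p : M → ℝ // p ∈ stdSimplex ℝ M} := by
  classical exact ⟨Pi.single m 1, single_mem_stdSimplex ℝ m⟩

@[simp] theorem pureMessage_self (m : M) : (pureMessage m).1 m = 1 := by
  simp [pureMessage]

theorem pureMessage_of_ne {m m' : M} (h : m' ≠ m) : (pureMessage m).1 m' = 0 := by
  simp [pureMessage, h]

/-- The even lottery over two messages. -/
noncomputable def evenMessage (m m' : M) : {p : M → ℝ // p ∈ stdSimplex ℝ M} :=
  ⟨(1 / 2 : ℝ) • (pureMessage m).1 + (1 / 2 : ℝ) • (pureMessage m').1,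
    convex_stdSimplex ℝ M (pureMessage m).2 (pureMessage m').2
      (by norm_num) (by norm_num) (by norm_num)⟩

theorem evenMessage_apply (m m' x : M) :
    (evenMessage m m').1 x = 1 / 2 * (pureMessage m).1 x + 1 / 2 * (pureMessage m').1 x := rfl

theorem evenMessage_left {m m' : M} (h : m ≠ m') : (evenMessage m m').1 m = 1 / 2 := by
  simp [evenMessage_apply, pureMessage_of_ne h]

theorem evenMessage_right {m m' : M} (h : m ≠ m') : (evenMessage m m').1 m' = 1 / 2 := by
  simp [evenMessage_apply, pureMessage_of_ne h.symm]

theorem evenMessage_of_ne {m m' x : M} (h : x ≠ m) (h' : x ≠ m') :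
    (evenMessage m m').1 x = 0 := by
  simp [evenMessage_apply, pureMessage_of_ne h, pureMessage_of_ne h']

theorem evenMessage_ne_one {m m' : M} (h : m ≠ m') (x : M) : (evenMessage m m').1 x ≠ 1 := by
  by_cases h1 : x = m
  · rw [h1, evenMessage_left h]; norm_num
  by_cases h2 : x = m'
  · rw [h2, evenMessage_right h]; norm_num
  rw [evenMessage_of_ne h1 h2]; norm_num

theorem strategy_eq_zero_of_eq_one {p : {p : M → ℝ // p ∈ stdSimplex ℝ M}} {m m' : M}
    (h : p.1 m = 1) (hne : m' ≠ m) : p.1 m' = 0 := by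
  classical
  have h2 := Finset.add_sum_erase Finset.univ p.1 (Finset.mem_univ m)
  rw [p.2.2, h, add_eq_left, Finset.sum_eq_zero_iff_of_nonneg fun i _ => p.2.1 i] at h2
  exact h2 m' (by simp [hne])

theorem exists_message_ne (G : CommunicationGame Θ M) (hn : Fintype.card Θ = 2) : ∃ m m' : M, m ≠ m' :=
  Fintype.one_lt_card_iff.1 (by have := G.card_le; omega)

/-! ### Full support of the prior -/

/-- Behaviour in a state of prior probability zero is irrelevant for polarization. -/
theorem IsPolarizing.update_null {G : CommunicationGame Θ M} {σ σ' : MessagingStrategy Θ M}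
    (hσ : G.IsPolarizing σ) (h : ∀ θ, G.ρ θ ≠ 0 → σ' θ = σ θ) : G.IsPolarizing σ' := by
  -- Message probabilities and posteriors see a strategy only through these products.
  have h1 (θ m) : (σ' θ).1 m * G.ρ θ = (σ θ).1 m * G.ρ θ := by
    by_cases h0 : G.ρ θ = 0
    · simp [h0]
    · rw [h θ h0]
  have h2 : G.messageProb σ' = G.messageProb σ := by
    funext m
    exact Finset.sum_congr rfl fun θ _ => h1 θ m
  have h3 : G.posterior σ' = G.posterior σ := by
    funext m θ
    simp only [posterior, h1, h2]
  have h4 : G.OnPath σ' = G.OnPath σ := by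
    funext m
    simp only [OnPath, h2]
  have h5 : G.spread σ' = G.spread σ := by
    simp only [spread, BestResponds, h3, h4]
  refine ⟨?_, fun σ'' h'' => h5 ▸ hσ.2 σ'' h''⟩
  simpa only [IsTwoMessage, h4] using hσ.1

/-- If the polarizing strategy is unique, then all states have positive prior probability. -/
theorem UniquePolarizing.prior_pos {G : CommunicationGame Θ M} (hn : Fintype.card Θ = 2)
    (h : G.UniquePolarizing) (θ : Θ) : 0 < G.ρ θ := by
  classical
  refine (G.ρ_mem.1 θ).lt_of_ne fun h0 => ?_
  obtain ⟨σ, hσ, huniq⟩ := h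
  obtain ⟨m, m', hne⟩ := G.exists_message_ne hn
  have hup (p) : G.IsPolarizing (Function.update σ θ p) := hσ.update_null fun θ' h' =>
    Function.update_of_ne (by rintro rfl; exact h' h0.symm) _ _
  -- In a null state, a sure message and a fair coin over two messages would both be relabelings of
  -- `σ θ`, but only the first puts mass `1` on some message.
  obtain ⟨e, he⟩ := huniq _ (hup (pureMessage m))
  obtain ⟨e', he'⟩ := huniq _ (hup (evenMessage m m'))
  have h1 := he θ m
  have h2 := he' θ (e'.symm (e m))
  rw [Function.update_self] at h1 h2
  rw [pureMessage_self] at h1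
  rw [Equiv.apply_symm_apply, ← h1] at h2
  exact evenMessage_ne_one hne _ h2

/-! ### On-path messages, posteriors and extreme responses -/

theorem messageProb_pos (hρ : ∀ θ, 0 < G.ρ θ) {σ : MessagingStrategy Θ M} {θ : Θ} {m : M}
    (h : 0 < (σ θ).1 m) : G.OnPath σ m :=
  (mul_pos h (hρ θ)).trans_le (Finset.single_le_sum
    (f := fun θ => (σ θ).1 m * G.ρ θ) (fun θ _ => mul_nonneg ((σ θ).2.1 m) (hρ θ).le)
    (Finset.mem_univ θ))

theorem OnPath.exists_pos {G : CommunicationGame Θ M} {σ : MessagingStrategy Θ M} {m : M}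
    (h : G.OnPath σ m) : ∃ θ, 0 < (σ θ).1 m := by
  by_contra! hc
  refine h.not_ge (Finset.sum_nonpos fun θ _ => mul_nonpos_of_nonpos_of_nonneg (hc θ)
    (G.ρ_mem.1 θ))

theorem posterior_nonneg (σ : MessagingStrategy Θ M) (m : M) (θ : Θ) : 0 ≤ G.posterior σ m θ :=
  div_nonneg (mul_nonneg ((σ θ).2.1 m) (G.ρ_mem.1 θ))
    (Finset.sum_nonneg fun θ _ => mul_nonneg ((σ θ).2.1 m) (G.ρ_mem.1 θ))

theorem mem_optimalActions_of_forall {μ : Θ → ℝ} (hμ : ∀ θ, 0 ≤ μ θ) {a : unitInterval}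
    (h : ∀ θ, 0 < μ θ → ∀ b, G.uP b θ ≤ G.uP a θ) : a ∈ G.optimalActions μ := by
  refine fun b => Finset.sum_le_sum fun θ _ => ?_
  obtain h0 | h0 := (hμ θ).eq_or_lt
  · simp [← h0]
  · exact mul_le_mul_of_nonneg_left (h θ h0 b) h0.le

theorem mem_optimalActions_posterior {σ : MessagingStrategy Θ M} {m : M} {a : unitInterval}
    (h : ∀ θ, 0 < (σ θ).1 m → ∀ b, G.uP b θ ≤ G.uP a θ) :
    a ∈ G.optimalActions (G.posterior σ m) := by
  refine G.mem_optimalActions_of_forall (G.posterior_nonneg σ m) fun θ hθ => h θ ?_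
  refine ((σ θ).2.1 m).lt_of_ne fun h0 => hθ.ne' ?_
  simp [posterior, ← h0]

/-- Action `1` after the message `m`, action `0` after all others. -/
noncomputable def extremeResponse (m : M) : ActionStrategy M := by
  classical exact fun x => if x = m then pureLottery 1 else pureLottery 0

theorem extremeResponse_self {M : Type*} (m : M) : extremeResponse m m = pureLottery 1 := by
  simp [extremeResponse]

theorem extremeResponse_of_ne {M : Type*} {m x : M} (h : x ≠ m) : extremeResponse m x = pureLottery 0 := by
  simp [extremeResponse, h]

theorem bestResponds_extremeResponse {σ : MessagingStrategy Θ M} {m₀ m₁ : M}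
    (hsupp : ∀ θ m, 0 < (σ θ).1 m → m = m₀ ∨ m = m₁)
    (h0 : ∀ θ, 0 < (σ θ).1 m₀ → ∀ b, G.uP b θ ≤ G.uP 0 θ)
    (h1 : ∀ θ, 0 < (σ θ).1 m₁ → ∀ b, G.uP b θ ≤ G.uP 1 θ) :
    G.BestResponds σ (extremeResponse m₁) := by
  intro m hm
  by_cases h : m = m₁
  · subst h
    rw [extremeResponse_self]
    exact G.isBestResponse_pureLottery (G.mem_optimalActions_posterior h1)
  · obtain ⟨θ, hθ⟩ := hm.exists_pos
    obtain rfl := (hsupp θ m hθ).resolve_right h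
    rw [extremeResponse_of_ne h]
    exact G.isBestResponse_pureLottery (G.mem_optimalActions_posterior h0)

theorem isTwoMessage_of_support {σ : MessagingStrategy Θ M} {m₀ m₁ : M} (hne : m₀ ≠ m₁)
    (hsupp : ∀ θ m, 0 < (σ θ).1 m → m = m₀ ∨ m = m₁) (hm₀ : G.OnPath σ m₀)
    (hm₁ : G.OnPath σ m₁) : G.IsTwoMessage σ := by
  have : {m | G.OnPath σ m} = {m₀, m₁} := by
    ext m
    refine ⟨fun h => ?_, ?_⟩
    · obtain ⟨θ, hθ⟩ := OnPath.exists_pos h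
      exact hsupp θ m hθ
    · rintro (rfl | rfl) <;> assumption
  rw [IsTwoMessage, this, Set.ncard_pair hne]

theorem isPolarizing_of_support {σ : MessagingStrategy Θ M} {m₀ m₁ : M} (hne : m₀ ≠ m₁)
    (hsupp : ∀ θ m, 0 < (σ θ).1 m → m = m₀ ∨ m = m₁) (hm₀ : G.OnPath σ m₀)
    (hm₁ : G.OnPath σ m₁) (h0 : ∀ θ, 0 < (σ θ).1 m₀ → ∀ b, G.uP b θ ≤ G.uP 0 θ)
    (h1 : ∀ θ, 0 < (σ θ).1 m₁ → ∀ b, G.uP b θ ≤ G.uP 1 θ) : G.IsPolarizing σ := by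
  refine (G.isTwoMessage_of_support hne hsupp hm₀ hm₁).isPolarizing
    (G.bestResponds_extremeResponse hsupp h0 h1) hne hm₀ hm₁ ?_ ?_
  · rw [extremeResponse_of_ne hne, agentUtility_pureLottery, G.uA_zero]
  · rw [extremeResponse_self, agentUtility_pureLottery, G.uA_one]

/-! ### Truth-telling and polarization with two states -/

theorem eq_or_eq_of_card_eq_two (hn : Fintype.card Θ = 2) {θ₀ θ₁ : Θ} (hne : θ₀ ≠ θ₁) (θ : Θ) :
    θ = θ₀ ∨ θ = θ₁ := by
  classical
  have h : ({θ₀, θ₁} : Finset Θ) = Finset.univ :=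
    Finset.eq_univ_of_card _ (by rw [Finset.card_pair hne, hn])
  have := Finset.mem_univ θ
  rw [← h] at this
  simpa using this

theorem sum_eq_add_of_card_eq_two (hn : Fintype.card Θ = 2) {θ₀ θ₁ : Θ} (hne : θ₀ ≠ θ₁)
    (f : Θ → ℝ) : ∑ θ, f θ = f θ₀ + f θ₁ := by
  classical
  have h : ({θ₀, θ₁} : Finset Θ) = Finset.univ :=
    Finset.eq_univ_of_card _ (by rw [Finset.card_pair hne, hn])
  rw [← h, Finset.sum_pair hne]

theorem eq_of_pos_of_eq_one {p : {p : M → ℝ // p ∈ stdSimplex ℝ M}} {m m' : M}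
    (h : p.1 m = 1) (h' : 0 < p.1 m') : m' = m := by
  by_contra hne
  exact h'.ne' (strategy_eq_zero_of_eq_one h hne)

theorem IsTruthTelling.isPolarizing {G : CommunicationGame Θ M} (hn : Fintype.card Θ = 2)
    (hρ : ∀ θ, 0 < G.ρ θ) {σ : MessagingStrategy Θ M} (hσ : IsTruthTelling σ) :
    G.IsPolarizing σ := by
  obtain ⟨f, hf, hσ⟩ := hσ
  obtain ⟨θ₀, θ₁, hne, h0, h1⟩ := G.extreme_optimal
  have hpos (θ) : G.OnPath σ (f θ) :=
    G.messageProb_pos hρ (θ := θ) (by rw [hσ]; exact zero_lt_one)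
  refine G.isPolarizing_of_support (hf.ne hne) (fun θ m hm => ?_) (hpos θ₀) (hpos θ₁) ?_ ?_
  · obtain rfl := eq_of_pos_of_eq_one (hσ θ) hm
    obtain rfl | rfl := eq_or_eq_of_card_eq_two hn hne θ <;> simp
  · intro θ hθ
    obtain rfl := hf (eq_of_pos_of_eq_one (hσ θ) hθ)
    exact h0
  · intro θ hθ
    obtain rfl := hf (eq_of_pos_of_eq_one (hσ θ) hθ)
    exact h1

theorem exists_isTruthTelling (G : CommunicationGame Θ M) :
    ∃ σ : MessagingStrategy Θ M, IsTruthTelling σ := by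
  obtain ⟨f⟩ := Function.Embedding.nonempty_of_card_le G.card_le
  exact ⟨fun θ => pureMessage (f θ), f, f.injective, fun θ => pureMessage_self _⟩

/-- Truth-telling strategies exist and are polarizing, so any polarizing strategy is a relabeling of
one of them, and relabeling preserves truth-telling. -/
theorem UniquePolarizing.isPolarizing_iff {G : CommunicationGame Θ M}
    (hn : Fintype.card Θ = 2) (h : G.UniquePolarizing) (σ : MessagingStrategy Θ M) :
    G.IsPolarizing σ ↔ IsTruthTelling σ := by
  have hρ := h.prior_pos hn
  refine ⟨fun hσ => ?_, IsTruthTelling.isPolarizing hn hρ⟩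
  obtain ⟨σ', hσ'⟩ := G.exists_isTruthTelling
  obtain ⟨σ₀, -, huniq⟩ := h
  obtain ⟨e, he⟩ := huniq σ hσ
  obtain ⟨e', he'⟩ := huniq σ' (hσ'.isPolarizing hn hρ)
  obtain ⟨f, hf, h1⟩ := hσ'
  refine ⟨fun θ => e.symm (e' (f θ)), fun _ _ hxy => hf (by simpa using hxy), fun θ => ?_⟩
  rw [he, Equiv.apply_symm_apply, ← he', h1]

/-- If the polarizing strategy is unique, an extreme action is not optimal in both states. -/
theorem UniquePolarizing.not_optimal_one {G : CommunicationGame Θ M}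
    (hn : Fintype.card Θ = 2) (h : G.UniquePolarizing) {θ₀ θ₁ : Θ} (hne : θ₀ ≠ θ₁)
    (h0 : ∀ a, G.uP a θ₀ ≤ G.uP 0 θ₀) (h1 : ∀ a, G.uP a θ₁ ≤ G.uP 1 θ₁) :
    ¬ ∀ a, G.uP a θ₀ ≤ G.uP 1 θ₀ := by
  classical
  intro h01
  have hρ := h.prior_pos hn
  obtain ⟨m₀, m₁, hm⟩ := G.exists_message_ne hn
  -- If `0` and `1` were both optimal in `θ₀`, that state could randomize without destroying the
  -- extreme responses: a polarizing strategy that is not truth-telling.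
  let σ : MessagingStrategy Θ M := fun θ =>
    if θ = θ₀ then evenMessage m₀ m₁ else pureMessage m₁
  have hσ₀ : σ θ₀ = evenMessage m₀ m₁ := if_pos rfl
  have hσ₁ : σ θ₁ = pureMessage m₁ := if_neg hne.symm
  have hpol : G.IsPolarizing σ := by
    refine G.isPolarizing_of_support hm (fun θ m hθ => ?_)
      (G.messageProb_pos hρ (θ := θ₀) ?_) (G.messageProb_pos hρ (θ := θ₁) ?_) ?_ ?_
    · by_contra! hc
      obtain rfl | rfl := eq_or_eq_of_card_eq_two hn hne θ
      · rw [hσ₀, evenMessage_of_ne hc.1 hc.2] at hθ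
        exact hθ.false
      · rw [hσ₁, pureMessage_of_ne hc.2] at hθ
        exact hθ.false
    · rw [hσ₀, evenMessage_left hm]; norm_num
    · rw [hσ₁, pureMessage_self]; norm_num
    · intro θ hθ
      obtain rfl | rfl := eq_or_eq_of_card_eq_two hn hne θ
      · exact h0
      · rw [hσ₁, pureMessage_of_ne hm] at hθ
        exact absurd hθ (lt_irrefl _)
    · intro θ hθ
      obtain rfl | rfl := eq_or_eq_of_card_eq_two hn hne θ
      · exact h01
      · exact h1
  obtain ⟨f, -, hf⟩ := (h.isPolarizing_iff hn σ).1 hpol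
  have := hf θ₀
  rw [hσ₀] at this
  exact evenMessage_ne_one hm _ this

/-! ### Consequences of no perfect pooling and of full revelation -/

theorem messageProb_lt_one_iff_exists (hρ : ∀ θ, 0 < G.ρ θ) (σ : MessagingStrategy Θ M) (m : M) :
    G.messageProb σ m < 1 ↔ ∃ θ, (σ θ).1 m < 1 := by
  have hle (θ) : (σ θ).1 m ≤ 1 := (mem_Icc_of_mem_stdSimplex (σ θ).2 m).2
  have hsum : G.messageProb σ m < 1 ↔ ∑ θ, (σ θ).1 m * G.ρ θ < ∑ θ, G.ρ θ := by
    rw [G.ρ_mem.2, messageProb]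
  rw [hsum]
  constructor
  · intro h
    by_contra! hc
    exact h.ne (Finset.sum_congr rfl fun θ _ => by rw [(hle θ).antisymm (hc θ), one_mul])
  · rintro ⟨θ, hθ⟩
    exact Finset.sum_lt_sum (fun θ _ => mul_le_of_le_one_left (hρ θ).le (hle θ))
      ⟨θ, Finset.mem_univ θ, mul_lt_of_lt_one_left (hρ θ) hθ⟩

/-- Without perfect pooling on either message, both messages of a two-element support are sent. -/
theorem exists_pos_of_messageProb_lt_one (hρ : ∀ θ, 0 < G.ρ θ) {σ : MessagingStrategy Θ M}
    {m₀ m₁ : M} (hsupp : ∀ θ m, 0 < (σ θ).1 m → m = m₀ ∨ m = m₁)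
    (h : G.messageProb σ m₀ < 1) : G.OnPath σ m₁ := by
  classical
  obtain ⟨θ, hθ⟩ := (G.messageProb_lt_one_iff_exists hρ σ m₀).1 h
  refine G.messageProb_pos hρ (θ := θ) (((σ θ).2.1 m₁).lt_of_ne fun h0 => hθ.ne ?_)
  rw [← (σ θ).2.2]
  refine (Finset.sum_eq_single m₀ (fun m _ hm => ?_) (by simp)).symm
  by_contra hc
  obtain h | rfl := hsupp θ m (((σ θ).2.1 m).lt_of_ne (Ne.symm hc))
  · exact hm h
  · exact hc h0.symm

/-- In state `θ`, if the on-path message `m` is sent in state `θ` only, what is optimal after `m`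
is optimal in state `θ`. -/
theorem optimal_of_mem_optimalActions_posterior {σ : MessagingStrategy Θ M} {m : M}
    (hm : G.OnPath σ m) {θ : Θ} (h : ∀ θ', θ' ≠ θ → (σ θ').1 m = 0) {a : unitInterval}
    (ha : a ∈ G.optimalActions (G.posterior σ m)) (b : unitInterval) :
    G.uP b θ ≤ G.uP a θ := by
  classical
  have hz (θ') (h' : θ' ≠ θ) : G.posterior σ m θ' = 0 := by simp [posterior, h θ' h']
  have hs (x) : ∑ θ', G.posterior σ m θ' * G.uP x θ' = G.posterior σ m θ * G.uP x θ :=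
    Finset.sum_eq_single θ (fun θ' _ h' => by rw [hz θ' h', zero_mul]) (by simp)
  have hpos : 0 < G.posterior σ m θ := by
    refine div_pos ?_ hm
    rwa [OnPath, messageProb, Finset.sum_eq_single θ (fun θ' _ h' => by rw [h θ' h', zero_mul])
      (by simp)] at hm
  have := ha b
  rw [hs, hs] at this
  exact le_of_mul_le_mul_left this hpos

/-! ### Separating mechanisms and their equilibria -/

/-- A mechanism whose two main messages give the agent utilities `x + ε` and `x`, all others giving
`0`, where the commitment level makes the gap `ε` worth exactly the full utility range of the
uncommitted principal. -/
structure IsSeparating (Q : Mechanism M) (m₀ m₁ : M) (ε x : ℝ) : Prop where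
  ne : m₀ ≠ m₁
  eps_pos : 0 < ε
  x_pos : 0 < x
  χ_pos : 0 < (Q.χ : ℝ)
  one_sub_χ : 1 - (Q.χ : ℝ) = ε * Q.χ
  left : G.agentUtility (Q.π m₀) = x + ε
  right : G.agentUtility (Q.π m₁) = x
  other : ∀ m, m ≠ m₀ → m ≠ m₁ → G.agentUtility (Q.π m) = 0

variable {G} {Q : Mechanism M} {m₀ m₁ : M} {ε x : ℝ}

theorem IsSeparating.messagePayoff (hQ : G.IsSeparating Q m₀ m₁ ε x) (τ : ActionStrategy M)
    (m : M) : G.messagePayoff Q τ m =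
      Q.χ * (G.agentUtility (Q.π m) + ε * G.agentUtility (τ m)) := by
  rw [CommunicationGame.messagePayoff, hQ.one_sub_χ]
  ring

/-- Every equilibrium of a separating mechanism is the intended truth-telling one. -/
theorem IsSeparating.truthful (hQ : G.IsSeparating Q m₀ m₁ ε x) (hn : Fintype.card Θ = 2)
    (h : G.UniquePolarizing) {θ₀ θ₁ : Θ} (hne : θ₀ ≠ θ₁)
    (h0 : ∀ a, G.uP a θ₀ ≤ G.uP 0 θ₀) (h1 : ∀ a, G.uP a θ₁ ≤ G.uP 1 θ₁)
    {σ : MessagingStrategy Θ M} {τ : ActionStrategy M} (hE : G.IsEquilibrium Q σ τ) :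
    (σ θ₀).1 m₀ = 1 ∧ (σ θ₁).1 m₁ = 1 := by
  have hρ := h.prior_pos hn
  have hχ := hQ.χ_pos
  have hε := hQ.eps_pos
  have hopt {θ m} (hm : 0 < (σ θ).1 m) (m') :
      G.agentUtility (Q.π m') + ε * G.agentUtility (τ m') ≤
        G.agentUtility (Q.π m) + ε * G.agentUtility (τ m) := by
    have := hE.agent_optimal θ m hm m'
    rw [hQ.messagePayoff, hQ.messagePayoff] at this
    exact le_of_mul_le_mul_left this hχ
  -- Up to the factor `χ`, any other message is worth at most `ε`, while `m₀` is worth at least `x +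
  -- ε`.
  have hsupp (θ m) (hm : 0 < (σ θ).1 m) : m = m₀ ∨ m = m₁ := by
    by_contra! hc
    have := hopt hm m₀
    rw [hQ.left, hQ.other m hc.1 hc.2] at this
    nlinarith [hQ.x_pos, (G.agentUtility_mem (τ m)).2, (G.agentUtility_mem (τ m₀)).1]
  have hm₁ := G.exists_pos_of_messageProb_lt_one hρ hsupp (hE.no_perfect_pooling m₀)
  have hm₀ := G.exists_pos_of_messageProb_lt_one hρ (fun θ m hm => (hsupp θ m hm).symm)
    (hE.no_perfect_pooling m₁)
  obtain ⟨_, hs₀⟩ := hm₀.exists_pos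
  obtain ⟨_, hs₁⟩ := hm₁.exists_pos
  have heq := (hopt hs₁ m₀).antisymm (hopt hs₀ m₁)
  rw [hQ.left, hQ.right] at heq
  -- Indifference makes the two responses differ by the full length of `[0,1]`, so they sit at its
  -- endpoints.
  have hgap : G.agentUtility (τ m₁) = 1 + G.agentUtility (τ m₀) := by
    refine mul_left_cancel₀ hε.ne' ?_
    linarith
  have hτ₀ : G.agentUtility (τ m₀) = 0 :=
    le_antisymm (by linarith [(G.agentUtility_mem (τ m₁)).2]) (G.agentUtility_mem (τ m₀)).1
  have hτ₁ : G.agentUtility (τ m₁) = 1 := by rw [hgap, hτ₀, add_zero]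
  have hpol : G.IsPolarizing σ :=
    (G.isTwoMessage_of_support hQ.ne hsupp hm₀ hm₁).isPolarizing hE.principal_optimal hQ.ne
      hm₀ hm₁ hτ₀ hτ₁
  obtain ⟨f, hf, hfσ⟩ := (h.isPolarizing_iff hn σ).1 hpol
  have hfm (θ) : f θ = m₀ ∨ f θ = m₁ := hsupp θ _ (by rw [hfσ]; exact zero_lt_one)
  -- With the roles swapped, `m₁` would reveal `θ₀` and yet be answered by action `1`, which is not
  -- optimal there.
  have hf₀ : f θ₀ = m₀ := by
    refine (hfm θ₀).resolve_right fun hc => ?_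
    refine h.not_optimal_one hn hne h0 h1 ?_
    refine G.optimal_of_mem_optimalActions_posterior hm₁ (fun θ hθ => ?_)
      (G.one_mem_optimalActions (hE.principal_optimal m₁ hm₁) hτ₁)
    exact strategy_eq_zero_of_eq_one (hfσ θ) (hc ▸ hf.ne hθ.symm)
  have hf₁ : f θ₁ = m₁ := (hfm θ₁).resolve_left fun hc => hf.ne hne (hf₀.trans hc.symm)
  exact ⟨hf₀ ▸ hfσ θ₀, hf₁ ▸ hfσ θ₁⟩

/-- Existence matters because the worst payoff of a mechanism without equilibria defaults to the
no-communication payoff. Truth-telling with extreme responses works: `m₀` and `m₁` are both worth `χ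
* (x + ε)`. -/
theorem IsSeparating.exists_isEquilibrium (hQ : G.IsSeparating Q m₀ m₁ ε x)
    (hn : Fintype.card Θ = 2) (hρ : ∀ θ, 0 < G.ρ θ) {θ₀ θ₁ : Θ} (hne : θ₀ ≠ θ₁)
    (h0 : ∀ a, G.uP a θ₀ ≤ G.uP 0 θ₀) (h1 : ∀ a, G.uP a θ₁ ≤ G.uP 1 θ₁) :
    ∃ (σ : MessagingStrategy Θ M) (τ : ActionStrategy M), G.IsEquilibrium Q σ τ := by
  classical
  have hm := hQ.ne
  let σ : MessagingStrategy Θ M := fun θ => if θ = θ₀ then pureMessage m₀ else pureMessage m₁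
  have hσ₀ : σ θ₀ = pureMessage m₀ := if_pos rfl
  have hσ₁ : σ θ₁ = pureMessage m₁ := if_neg hne.symm
  have hsent (θ m) (hθ : 0 < (σ θ).1 m) : (θ = θ₀ ∧ m = m₀) ∨ (θ = θ₁ ∧ m = m₁) := by
    obtain rfl | rfl := eq_or_eq_of_card_eq_two hn hne θ
    · exact Or.inl ⟨rfl, eq_of_pos_of_eq_one (pureMessage_self m₀) (hσ₀ ▸ hθ)⟩
    · exact Or.inr ⟨rfl, eq_of_pos_of_eq_one (pureMessage_self m₁) (hσ₁ ▸ hθ)⟩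
  have hon₁ : G.OnPath σ m₁ :=
    G.messageProb_pos hρ (θ := θ₁) (by rw [hσ₁, pureMessage_self]; exact zero_lt_one)
  have hpay₀ : G.messagePayoff Q (extremeResponse m₁) m₀ = Q.χ * (x + ε) := by
    rw [hQ.messagePayoff, hQ.left, extremeResponse_of_ne hm, agentUtility_pureLottery, G.uA_zero,
      mul_zero, add_zero]
  have hpay₁ : G.messagePayoff Q (extremeResponse m₁) m₁ = Q.χ * (x + ε) := by
    rw [hQ.messagePayoff, hQ.right, extremeResponse_self, agentUtility_pureLottery, G.uA_one,
      mul_one]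
  have hpay (m) : G.messagePayoff Q (extremeResponse m₁) m ≤ Q.χ * (x + ε) := by
    by_cases h₀ : m = m₀
    · exact (h₀ ▸ hpay₀).le
    by_cases h₁ : m = m₁
    · rw [h₁]
      exact hpay₁.le
    rw [hQ.messagePayoff, hQ.other m h₀ h₁, extremeResponse_of_ne h₁, agentUtility_pureLottery,
      G.uA_zero, mul_zero, add_zero, mul_zero]
    exact mul_nonneg hQ.χ_pos.le (add_pos hQ.x_pos hQ.eps_pos).le
  have hoff (m) (h : ¬ G.OnPath σ m) : extremeResponse m₁ m = pureLottery 0 :=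
    extremeResponse_of_ne fun hc => h (hc ▸ hon₁)
  refine ⟨σ, extremeResponse m₁, ⟨?_, ?_, ?_, hoff, ?_⟩⟩
  · intro θ m hθ m'
    obtain ⟨-, rfl⟩ | ⟨-, rfl⟩ := hsent θ m hθ
    · exact hpay₀ ▸ hpay m'
    · exact hpay₁ ▸ hpay m'
  · refine G.bestResponds_extremeResponse (m₀ := m₀) (fun θ m hθ => ?_) (fun θ hθ => ?_)
      (fun θ hθ => ?_)
    · exact (hsent θ m hθ).imp And.right And.right
    · obtain ⟨rfl, -⟩ | ⟨-, h⟩ := hsent θ m₀ hθ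
      · exact h0
      · exact absurd h hm
    · obtain ⟨-, h⟩ | ⟨rfl, -⟩ := hsent θ m₁ hθ
      · exact absurd h.symm hm
      · exact h1
  · intro m hm
    -- Certainty of `θ₀` justifies the pessimistic action `0`.
    refine ⟨Pi.single θ₀ 1, single_mem_stdSimplex ℝ θ₀, ?_⟩
    rw [hoff m hm]
    refine G.isBestResponse_pureLottery (G.mem_optimalActions_of_forall
      (single_mem_stdSimplex ℝ θ₀).1 fun θ hθ => ?_)
    obtain rfl : θ = θ₀ := by
      by_contra hc
      simp [hc] at hθ
    exact h0
  · intro m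
    rw [G.messageProb_lt_one_iff_exists hρ]
    by_cases h : m = m₀
    · exact ⟨θ₁, by rw [hσ₁, h, pureMessage_of_ne hm]; exact zero_lt_one⟩
    · exact ⟨θ₀, by rw [hσ₀, pureMessage_of_ne h]; exact zero_lt_one⟩

/-! ### Guaranteed payoffs and the limit of small gaps -/

theorem prior_mul_le_sum (G : CommunicationGame Θ M) {σ : MessagingStrategy Θ M} {θ : Θ} {m : M}
    (h : (σ θ).1 m = 1) (l : M → ProbabilityMeasure unitInterval) :
    G.ρ θ * G.principalUtility (l m) θ ≤
      ∑ m, G.ρ θ * (σ θ).1 m * G.principalUtility (l m) θ := by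
  refine le_trans (by rw [h, mul_one]) (Finset.single_le_sum
    (f := fun m => G.ρ θ * (σ θ).1 m * G.principalUtility (l m) θ)
    (fun m _ => ?_) (Finset.mem_univ m))
  exact mul_nonneg (mul_nonneg (G.ρ_mem.1 θ) ((σ θ).2.1 m)) (G.principalUtility_mem _ _).1

/-- The uncommitted part of the payoff is nonnegative and is dropped. -/
theorem le_payoff_of_truthful (hn : Fintype.card Θ = 2) {θ₀ θ₁ : Θ} (hne : θ₀ ≠ θ₁)
    {σ : MessagingStrategy Θ M} (hσ₀ : (σ θ₀).1 m₀ = 1) (hσ₁ : (σ θ₁).1 m₁ = 1)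
    (τ : ActionStrategy M) :
    Q.χ * (G.ρ θ₀ * G.principalUtility (Q.π m₀) θ₀ + G.ρ θ₁ * G.principalUtility (Q.π m₁) θ₁) ≤
      G.payoff Q σ τ := by
  have h := (G.sum_prior_strategy_mul_mem σ (fun m θ => G.principalUtility (τ m) θ)
    fun m θ => G.principalUtility_mem _ _).1
  refine le_add_of_le_of_nonneg (mul_le_mul_of_nonneg_left ?_ Q.χ.2.1)
    (mul_nonneg (sub_nonneg.2 Q.χ.2.2) h)
  rw [sum_eq_add_of_card_eq_two hn hne]
  exact add_le_add (G.prior_mul_le_sum hσ₀ Q.π) (G.prior_mul_le_sum hσ₁ Q.π)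

theorem IsSeparating.le_worstPayoff (hQ : G.IsSeparating Q m₀ m₁ ε x) (hn : Fintype.card Θ = 2)
    (h : G.UniquePolarizing) {θ₀ θ₁ : Θ} (hne : θ₀ ≠ θ₁)
    (h0 : ∀ a, G.uP a θ₀ ≤ G.uP 0 θ₀) (h1 : ∀ a, G.uP a θ₁ ≤ G.uP 1 θ₁) :
    Q.χ * (G.ρ θ₀ * G.principalUtility (Q.π m₀) θ₀ + G.ρ θ₁ * G.principalUtility (Q.π m₁) θ₁) ≤
      G.worstPayoff Q := by
  have hne' : (G.equilibriumPayoffs Q).Nonempty := by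
    obtain ⟨σ, τ, hE⟩ := hQ.exists_isEquilibrium hn (h.prior_pos hn) hne h0 h1
    exact ⟨_, σ, τ, hE, rfl⟩
  rw [worstPayoff, if_pos hne']
  refine le_csInf hne' ?_
  rintro _ ⟨σ, τ, hE, rfl⟩
  obtain ⟨hσ₀, hσ₁⟩ := hQ.truthful hn h hne h0 h1 hE
  exact le_payoff_of_truthful hn hne hσ₀ hσ₁ τ

theorem UniquePolarizing.le_worstCaseOptimalPayoff_of_pos (h : G.UniquePolarizing)
    (hn : Fintype.card Θ = 2)
    {θ₀ θ₁ : Θ} (hne : θ₀ ≠ θ₁) (h0 : ∀ a, G.uP a θ₀ ≤ G.uP 0 θ₀)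
    (h1 : ∀ a, G.uP a θ₁ ≤ G.uP 1 θ₁) {l₀ l₁ : ProbabilityMeasure unitInterval}
    (hl : G.agentUtility l₀ = G.agentUtility l₁) (hε : 0 < ε) (hε' : ε < 1 / 2) :
    (1 + ε)⁻¹ * ((1 - 2 * ε) *
      (G.ρ θ₀ * G.principalUtility l₀ θ₀ + G.ρ θ₁ * G.principalUtility l₁ θ₁)) ≤
      G.worstCaseOptimalPayoff := by
  classical
  obtain ⟨m₀, m₁, hm⟩ := G.exists_message_ne hn
  -- Moving weight `2 * ε` to action `1` contributes `2 * ε` to the agent's utility; moving it to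
  -- the fair coin `C` between `0` and `1` contributes `ε`. The gap is thus `ε`, and the lower
  -- utility stays positive even if `l₁` gives `0`.
  obtain ⟨A, hA⟩ := exists_mixture_two (s := 1 - 2 * ε) (t := 2 * ε) (by linarith) (by linarith)
    (by ring) l₀ (pureLottery 1)
  obtain ⟨C, hC⟩ := exists_mixture_two (s := 1 / 2) (t := 1 / 2) (by norm_num) (by norm_num)
    (by norm_num) (pureLottery 0) (pureLottery 1)
  obtain ⟨B, hB⟩ := exists_mixture_two (s := 1 - 2 * ε) (t := 2 * ε) (by linarith) (by linarith)
    (by ring) l₁ C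
  have hχ : (1 + ε)⁻¹ < 1 := inv_lt_one_of_one_lt₀ (by linarith)
  -- The value `χ = (1 + ε)⁻¹` solves `1 - χ = ε * χ`.
  let Q : Mechanism M :=
    ⟨fun m => if m = m₀ then A else if m = m₁ then B else pureLottery 0,
      ⟨(1 + ε)⁻¹, by positivity, hχ.le⟩⟩
  have hπ₀ : Q.π m₀ = A := if_pos rfl
  have hπ₁ : Q.π m₁ = B := (if_neg hm.symm).trans (if_pos rfl)
  have hAu : G.agentUtility A = (1 - 2 * ε) * G.agentUtility l₁ + ε + ε := by
    rw [agentUtility, hA _ G.uA_continuous, integral_pureLottery, G.uA_one, ← hl, agentUtility]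
    ring
  have hBu : G.agentUtility B = (1 - 2 * ε) * G.agentUtility l₁ + ε := by
    rw [agentUtility, hB _ G.uA_continuous, hC _ G.uA_continuous, integral_pureLottery,
      integral_pureLottery, G.uA_one, G.uA_zero, agentUtility]
    ring
  have hQ : G.IsSeparating Q m₀ m₁ ε ((1 - 2 * ε) * G.agentUtility l₁ + ε) := by
    refine ⟨hm, hε, ?_, ?_, ?_, hπ₀ ▸ hAu, hπ₁ ▸ hBu, fun m hm₀ hm₁ => ?_⟩
    · exact add_pos_of_nonneg_of_pos
        (mul_nonneg (by linarith) (G.agentUtility_mem l₁).1) hε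
    · change 0 < (1 + ε)⁻¹
      positivity
    · change 1 - (1 + ε)⁻¹ = ε * (1 + ε)⁻¹
      field_simp
      ring
    · have : Q.π m = pureLottery 0 := (if_neg hm₀).trans (if_neg hm₁)
      rw [this, agentUtility_pureLottery, G.uA_zero]
  have hAp : (1 - 2 * ε) * G.principalUtility l₀ θ₀ ≤ G.principalUtility A θ₀ := by
    have : G.principalUtility A θ₀ = _ := hA _ (G.uP_continuous θ₀)
    rw [this]
    exact le_add_of_nonneg_right
      (mul_nonneg (by linarith) (G.principalUtility_mem (pureLottery 1) θ₀).1)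
  have hBp : (1 - 2 * ε) * G.principalUtility l₁ θ₁ ≤ G.principalUtility B θ₁ := by
    have : G.principalUtility B θ₁ = _ := hB _ (G.uP_continuous θ₁)
    rw [this]
    exact le_add_of_nonneg_right
      (mul_nonneg (by linarith) (G.principalUtility_mem C θ₁).1)
  refine le_trans ?_ ((hQ.le_worstPayoff hn h hne h0 h1).trans
    (G.worstPayoff_le_worstCaseOptimalPayoff Q hχ))
  rw [hπ₀, hπ₁]
  refine mul_le_mul_of_nonneg_left ?_ (inv_nonneg.2 (by linarith))
  have e0 := mul_le_mul_of_nonneg_left hAp (G.ρ_mem.1 θ₀)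
  have e1 := mul_le_mul_of_nonneg_left hBp (G.ρ_mem.1 θ₁)
  linarith

/-- The worst-case optimal payoff is at least the payoff of any lotteries, one for each state,
between which the agent is indifferent. -/
theorem UniquePolarizing.le_worstCaseOptimalPayoff (h : G.UniquePolarizing)
    (hn : Fintype.card Θ = 2) {L : Θ → ProbabilityMeasure unitInterval} {u : ℝ}
    (hL : ∀ θ, G.agentUtility (L θ) = u) :
    ∑ θ, G.ρ θ * G.principalUtility (L θ) θ ≤ G.worstCaseOptimalPayoff := by
  obtain ⟨θ₀, θ₁, hne, h0, h1⟩ := G.extreme_optimal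
  rw [sum_eq_add_of_card_eq_two hn hne]
  have hcont : ContinuousAt (fun ε : ℝ => (1 + ε)⁻¹ * ((1 - 2 * ε) *
      (G.ρ θ₀ * G.principalUtility (L θ₀) θ₀ + G.ρ θ₁ * G.principalUtility (L θ₁) θ₁))) 0 := by
    refine ContinuousAt.mul (ContinuousAt.inv₀ (by fun_prop) (by norm_num)) (by fun_prop)
  -- The guarantee holds only for small positive `ε`, so the limit is taken from the right.
  have hlim := hcont.tendsto.mono_left (nhdsWithin_le_nhds (s := Set.Ioi 0))
  simp only [add_zero, inv_one, mul_zero, sub_zero, one_mul] at hlim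
  refine le_of_tendsto hlim ?_
  filter_upwards [Ioo_mem_nhdsGT (show (0 : ℝ) < 1 / 2 by norm_num)] with ε hε
  exact h.le_worstCaseOptimalPayoff_of_pos hn hne h0 h1 ((hL θ₀).trans (hL θ₁).symm) hε.1 hε.2

/-! ### Every equilibrium payoff is attainable in the worst case -/

/-- An equilibrium payoff is generated by one lottery per state, between which the agent is
indifferent. -/
theorem IsEquilibrium.exists_lotteries {σ : MessagingStrategy Θ M} {τ : ActionStrategy M}
    (hE : G.IsEquilibrium Q σ τ) :
    ∃ (L : Θ → ProbabilityMeasure unitInterval) (u : ℝ), (∀ θ, G.agentUtility (L θ) = u) ∧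
      G.payoff Q σ τ = ∑ θ, G.ρ θ * G.principalUtility (L θ) θ := by
  -- `l m` is the overall lottery after `m`, with commitment averaged out; `L θ` then averages it
  -- over the messages sent in `θ`.
  choose l hl using fun m => exists_mixture_two Q.χ.2.1 (sub_nonneg.2 Q.χ.2.2)
    (add_sub_cancel _ _) (Q.π m) (τ m)
  choose L hL using fun θ => exists_mixture (σ θ).2 l
  have hla (m) : G.agentUtility (l m) = G.messagePayoff Q τ m := hl m _ G.uA_continuous
  obtain ⟨θ', -⟩ := G.extreme_optimal
  have hsent : ∃ m, 0 < (σ θ').1 m := by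
    by_contra! hc
    have := Finset.sum_nonpos fun m (_ : m ∈ Finset.univ) => hc m
    rw [(σ θ').2.2] at this
    linarith
  obtain ⟨m', hm'⟩ := hsent
  refine ⟨L, G.messagePayoff Q τ m', fun θ => ?_, ?_⟩
  · calc G.agentUtility (L θ) = ∑ m, (σ θ).1 m * G.agentUtility (l m) := hL θ _ G.uA_continuous
      _ = ∑ m, (σ θ).1 m * G.messagePayoff Q τ m' := by
          refine Finset.sum_congr rfl fun m _ => ?_
          obtain h0 | hm := ((σ θ).2.1 m).eq_or_lt
          · rw [← h0, zero_mul, zero_mul]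
          · rw [hla, (hE.agent_optimal θ' m' hm' m).antisymm (hE.agent_optimal θ m hm m')]
      _ = G.messagePayoff Q τ m' := by rw [← Finset.sum_mul, (σ θ).2.2, one_mul]
  · rw [payoff, Finset.mul_sum, Finset.mul_sum, ← Finset.sum_add_distrib]
    refine Finset.sum_congr rfl fun θ _ => ?_
    have h1 : G.principalUtility (L θ) θ = ∑ m, (σ θ).1 m * _ := hL θ _ (G.uP_continuous θ)
    rw [h1, Finset.mul_sum, Finset.mul_sum, Finset.mul_sum, ← Finset.sum_add_distrib]
    refine Finset.sum_congr rfl fun m _ => ?_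
    rw [hl m _ (G.uP_continuous θ), principalUtility, principalUtility]
    ring

theorem UniquePolarizing.bestPayoff_le (h : G.UniquePolarizing) (hn : Fintype.card Θ = 2)
    (Q : Mechanism M) : G.bestPayoff Q ≤ G.worstCaseOptimalPayoff := by
  unfold bestPayoff
  split_ifs with hne
  · refine csSup_le hne ?_
    rintro _ ⟨σ, τ, hE, rfl⟩
    obtain ⟨L, u, hL, hp⟩ := hE.exists_lotteries
    exact hp ▸ h.le_worstCaseOptimalPayoff hn hL
  · refine ciSup_le fun a => ?_
    -- The default no-communication value is covered too: the same action in both states leaves the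
    -- agent indifferent.
    have := h.le_worstCaseOptimalPayoff hn (L := fun _ => pureLottery a) (fun _ => rfl)
    simpa only [principalUtility_pureLottery] using this

end CommunicationGame

theorem mainTheorem5 {Θ M : Type*} [Fintype Θ] [Fintype M] (G : CommunicationGame Θ M)
    (hn : Fintype.card Θ = 2) (hunique : G.UniquePolarizing) :
    G.worstCaseOptimalPayoff = G.optimalPayoff ∧
      ∀ σ : CommunicationGame.MessagingStrategy Θ M,
        G.IsPolarizing σ ↔ CommunicationGame.IsTruthTelling σ := by
  refine ⟨G.worstCaseOptimalPayoff_le_optimalPayoff.antisymm ?_, hunique.isPolarizing_iff hn⟩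
  have : Nonempty (CommunicationGame.Mechanism M) :=
    ⟨⟨fun _ => CommunicationGame.pureLottery 0, 0⟩⟩
  exact ciSup_le (hunique.bestPayoff_le hn)
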